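/- Let $\nu$ be a nonzero measure on a measurable space $\Theta$ and let $T:\Theta\to\mathbb{R}^d$ be a measurable statistic which is minimal, i.e. no nontrivial linear combination of its components is $\nu$-a.e. constant. Let $\Omega=\{\eta\in\mathbb{R}^d:\int e^{\eta^\top T}\,d\nu<\infty\}$, and for $\eta\in\Omega$ let $q_\eta(\theta)=\exp(\eta^\top T(\theta)-A(\eta))$ be the normalised exponential family density, with mean parameter $\mu_{q_\eta}=\mathbb{E}_{q_\eta}[T]$. A function $f$ is said to have natural parameter $\eta$ if $f(\theta)\propto\exp(\eta^\top T(\theta))$. Let the data be split into $M$ partitions (mini-batches) $\mathbf{y}_1,\dots,\mathbf{y}_M$ with likelihood factors $p(\mathbf{y}_m\mid\theta)$, and let $\rho\in\mathbb{R}$ be a damping factor. Let the prior $p(\theta)$ have natural parameter $\eta_0$, let the current approximate posterior $q(\theta)$ have natural parameter $\eta\in\operatorname{int}\Omega$, and let the current single average likelihood factor $t(\theta)>0$ satisfy $q(\theta)\propto p(\theta)\,t(\theta)^M$. One step of the stochastic power EP (SPEP) algorithm with power $\alpha>0$ on partition $k$ is: 1. form the tilted distribution $\hat p_\alpha(\theta)=q(\theta)\left(p(\mathbf{y}_k\mid\theta)/t(\theta)\right)^\alpha$;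 2. moment match: choose $q_\alpha$ in the exponential family (up to scale) such that $\mathbb{E}_{q_\alpha}[T]=\mathbb{E}_{\hat p_\alpha}[T]$, expectations being taken after normalisation; 3. update the approximate posterior: $q'(\theta)=q(\theta)^{1-M\rho/\alpha}\,q_\alpha(\theta)^{M\rho/\alpha}$; 4. update the average likelihood factor: $t'(\theta)=\left(q'(\theta)/p(\theta)\right)^{1/M}$. Assume that $p(\mathbf{y}_k\mid\cdot)$ is measurable and $\nu$-a.e. positive, that $\mathbb{E}_{q_{\tilde\eta}}|\log p(\mathbf{y}_k\mid\theta)|<\infty$ for all $\tilde\eta$ in a neighbourhood of $\eta$, and that for some $\alpha_0>0$ the tilted distribution $\hat p_{\alpha_0}$ is normalisable and $T$ has a finite expectation under it. Then the function $\mu_q\mapsto\mathbb{E}_q[\log p(\mathbf{y}_k\mid\theta)]$, on the mean parameters of the densities $q_{\tilde\eta}$, $\tilde\eta\in\operatorname{int}\Omega$, is differentiable at $\mu_{q_\eta}$; for all sufficiently small $\alpha>0$ the SPEP step can be carried out, and the natural parameters $\eta'_\alpha$ of $q'$ and $\tau'_\alpha$ of $t'$ exist and are uniquely determined; and, as $\alpha\to0^+$,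 they converge to the damped mini-batch simplified fixed-point update of global VI: $$\eta'_\alpha\;\longrightarrow\;\eta^{\mathrm{new}}:=(1-\rho)\,\eta+\rho\left(\eta_0+M\left.\frac{\mathrm{d}}{\mathrm{d}\mu_q}\mathbb{E}_q[\log p(\mathbf{y}_k\mid\theta)]\right|_{q=q_\eta}\right),\qquad \tau'_\alpha\;\longrightarrow\;\tfrac1M\left(\eta^{\mathrm{new}}-\eta_0\right).$$ Equivalently, $$\eta^{\mathrm{new}}=\eta+M\rho\left(\left.\frac{\mathrm{d}}{\mathrm{d}\mu_q}\mathbb{E}_q[\log p(\mathbf{y}_k\mid\theta)]\right|_{q=q_\eta}-\tfrac1M(\eta-\eta_0)\right).$$ -/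

import Mathlib

open MeasureTheory Filter Topology

noncomputable section

namespace SPEP

variable {Θ : Type*} {d : ℕ}

/-- The space of natural parameters and of mean parameters, `ℝ^d` with its Euclidean norm. -/
abbrev Param (d : ℕ) : Type := EuclideanSpace ℝ (Fin d)

/-- `f` is a (possibly unnormalised) member of the exponential family with sufficient statistic `T`
and natural parameter `η`, that is `f θ ∝ exp ⟪η, T θ⟫`. -/
def HasNatParam (T : Θ → Param d) (f : Θ → ℝ) (η : Param d) : Prop :=
  ∃ c : ℝ, ∀ θ, f θ = Real.exp (inner ℝ η (T θ) + c)

/-- The likelihood tilted by the power `α`: `q θ * (ℓ θ / t θ) ^ α`. -/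
def tilted (q t lik : Θ → ℝ) (α : ℝ) (θ : Θ) : ℝ :=
  q θ * (lik θ / t θ) ^ α

variable [MeasurableSpace Θ]

/-- The natural parameter space: all `η` for which `exp ⟪η, T θ⟫` is normalisable. -/
def natDomain (T : Θ → Param d) (ν : Measure Θ) : Set (Param d) :=
  {η | Integrable (fun θ => Real.exp (inner ℝ η (T θ))) ν}

/-- The partition function `∫ exp ⟪η, T θ⟫ dν`. -/
def partition (T : Θ → Param d) (ν : Measure Θ) (η : Param d) : ℝ :=
  ∫ θ, Real.exp (inner ℝ η (T θ)) ∂ν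

/-- The normalised density `q_η θ = exp (⟪η, T θ⟫ - A η)`, where `A = log (partition)`. -/
def density (T : Θ → Param d) (ν : Measure Θ) (η : Param d) (θ : Θ) : ℝ :=
  Real.exp (inner ℝ η (T θ) - Real.log (partition T ν η))

/-- The sufficient statistic is minimal: no nontrivial linear combination of its components is
almost everywhere constant. (Equivalently, natural parameters are identifiable, and the Fisher
information is invertible at the interior points of the natural parameter space.) -/
def IsMinimal (T : Θ → Param d) (ν : Measure Θ) : Prop :=
  ∀ v : Param d, (∃ c : ℝ, ∀ᵐ θ ∂ν, inner ℝ v (T θ) = c) → v = 0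

/-- The mean parameter `μ_η = E_{q_η} [T]`. -/
def meanParam (T : Θ → Param d) (ν : Measure Θ) (η : Param d) : Param d :=
  ∫ θ, density T ν η θ • T θ ∂ν

/-- The inverse `μ ↦ η` of the mean parameter map on the interior of the natural parameter space
(for a minimal statistic the map is injective there, with open image). -/
def natOfMean (T : Θ → Param d) (ν : Measure Θ) : Param d → Param d :=
  Function.invFunOn (meanParam T ν) (interior (natDomain T ν))

/-- `E_q [f]` as a function of the mean parameter of `q`. -/
def meanExpectation (T : Θ → Param d) (ν : Measure Θ) (f : Θ → ℝ) (μ : Param d) : ℝ :=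
  ∫ θ, density T ν (natOfMean T ν μ) θ * f θ ∂ν

/-- The derivative `(d / dμ_q) E_q [f]`, evaluated at `q = q_η`. -/
def meanGradient (T : Θ → Param d) (ν : Measure Θ) (f : Θ → ℝ) (η : Param d) : Param d :=
  gradient (meanExpectation T ν f) (meanParam T ν η)

/-- One damped simplified fixed-point update of global variational inference with prior parameter
`η₀`, current parameter `η` and damping `ρ`, where the log likelihood of the whole data set is
replaced by `L` times the log likelihood of one of `L` mini-batches:
`(1 - ρ) η + ρ (η₀ + L (d / dμ_q) E_q [log lik])` at `q = q_η`. -/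
def miniBatchUpdate (T : Θ → Param d) (ν : Measure Θ) (L : ℕ) (ρ : ℝ) (η₀ : Param d)
    (lik : Θ → ℝ) (η : Param d) : Param d :=
  (1 - ρ) • η + ρ • (η₀ + (L : ℝ) • meanGradient T ν (fun θ => Real.log (lik θ)) η)

/-- The expectation of `T` under the probability density proportional to `f`. -/
def expectT (T : Θ → Param d) (ν : Measure Θ) (f : Θ → ℝ) : Param d :=
  (∫ θ, f θ ∂ν)⁻¹ • ∫ θ, f θ • T θ ∂ν

/-- `f` is the density, up to a positive constant, of a probability measure under which `T` has an
expectation. -/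
structure HasMoments (T : Θ → Param d) (ν : Measure Θ) (f : Θ → ℝ) : Prop where
  nonneg : ∀ᵐ θ ∂ν, 0 ≤ f θ
  integrable : Integrable f ν
  mass_pos : 0 < ∫ θ, f θ ∂ν
  integrable_stat : Integrable (fun θ => f θ • T θ) ν

/-- `g = proj f`: the moment-matching projection of `f` on the exponential family. The scale of `g`
is left free, so that this covers both the projection on normalised densities and the one on
unnormalised densities which also matches the total mass. -/
structure IsMomentMatch (T : Θ → Param d) (ν : Measure Θ) (f g : Θ → ℝ) : Prop where
  mem_family : ∃ η ∈ natDomain T ν, HasNatParam T g η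
  source : HasMoments T ν f
  target : HasMoments T ν g
  expect_eq : expectT T ν g = expectT T ν f

/-- One step of stochastic power EP with power `α`, damping `ρ` and `M` data partitions, for a data
partition with likelihood `lik`. The input is the prior `p`, the current approximate posterior `q`
and the current average likelihood factor `t`; the output is the projection `qα` of the tilted
distribution, the new approximate posterior `q'` and the new average likelihood factor `t'`. -/
structure IsStep (T : Θ → Param d) (ν : Measure Θ) (M : ℕ) (ρ α : ℝ)
    (p lik q t qα q' t' : Θ → ℝ) : Prop where
  moment_match : IsMomentMatch T ν (tilted q t lik α) qα
  posterior : ∀ θ, q' θ = q θ ^ (1 - M * ρ / α) * qα θ ^ (M * ρ / α)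
  factor : ∀ θ, t' θ = (q' θ / p θ) ^ (1 / (M : ℝ))

/-- With power `α`, one step of stochastic power EP can be carried out and it returns an approximate
posterior with natural parameter `η'` and an average likelihood factor with natural parameter
`τ'`. -/
def Returns (T : Θ → Param d) (ν : Measure Θ) (M : ℕ) (ρ α : ℝ)
    (p lik q t : Θ → ℝ) (η' τ' : Param d) : Prop :=
  ∃ qα q' t' : Θ → ℝ, IsStep T ν M ρ α p lik q t qα q' t' ∧
    HasNatParam T q' η' ∧ HasNatParam T t' τ'

end SPEP

end

/-! In natural parameters a step is linear. If `e α` is the parameter of the projection of the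
tilted distribution, then `q'` has parameter `η + (M ρ / α) (e α - η)`. Since `e 0 = η`, the limit
as `α → 0⁺` is `η + M ρ e'(0⁺)`, and the theorem reduces to computing one right derivative.

Write `e = natOfMean ∘ m`, where `m α` is the mean of `T` under the tilted distribution.
Differentiating `∫ (lik / t) ^ α ...` at `α = 0` gives `m'(0⁺) = Cov_q(log (lik / t), T)`
(`hasDerivWithinAt_expectT_tilted`). The mean parameter map has derivative the Fisher information `K
= Cov_q(T, T)`, invertible by minimality, so by the inverse function theorem `natOfMean` has
derivative `K⁻¹`. By the chain rule, `K⁻¹ Cov_q(log lik, T)` is exactly the gradient of `E_q[log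
lik]` in the mean parameter (`covariance_stat_meanGradient`). Because `q ∝ p t ^ M`, `log t` is `⟪τ,
T⟫` plus a constant with `τ = (η - η₀) / M`, and it contributes `K⁻¹ K τ = τ` (`covVec_sub_inner`).
Hence `e'(0⁺)` is the gradient minus `τ`.

Two domination arguments support this. In `η`, integrability on a neighbourhood yields an
exponential margin in `‖T‖`, which permits differentiation under the integral. In `α`, the
difference quotients of `r ^ α` are bounded by `|log r| + r ^ b / b`. Uniqueness of the result is
injectivity of the mean parameter map, including boundary parameters. -/

namespace SPEP

/-! ### Exponential margins and differentiation of Laplace type integrals. -/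

variable {Θ : Type*} {d : ℕ}
  {E : Type*} [NormedAddCommGroup E] [NormedSpace ℝ E]
  {E' : Type*} [NormedAddCommGroup E'] [NormedSpace ℝ E']

/-- The tensor `v ↦ ⟪T θ, v⟫ g θ`. -/
noncomputable def statTensor (T : Θ → Param d) (g : Θ → E) (θ : Θ) : Param d →L[ℝ] E :=
  (innerSL ℝ (T θ)).smulRight (g θ)

lemma statTensor_apply (T : Θ → Param d) (g : Θ → E) (θ : Θ) (v : Param d) :
    statTensor T g θ v = inner ℝ (T θ) v • g θ := rfl

lemma norm_statTensor (T : Θ → Param d) (g : Θ → E) (θ : Θ) :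
    ‖statTensor T g θ‖ = ‖T θ‖ * ‖g θ‖ := by
  rw [statTensor, ContinuousLinearMap.norm_smulRight_apply, innerSL_apply_norm]

lemma statTensor_sub (T : Θ → Param d) (μ : Param d) (g : Θ → E) (θ : Θ) :
    statTensor (fun θ => T θ - μ) g θ =
      statTensor T g θ - (innerSL ℝ μ).smulRight (g θ) := by
  ext v
  simp [statTensor_apply, inner_sub_left, sub_smul]

lemma norm_le_card_mul_abs_or_eq_zero (x : Param d) :
    x = 0 ∨ ∃ i, ‖x‖ ≤ d * |x i| := by
  rcases isEmpty_or_nonempty (Fin d) with h | h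
  · left; ext i; exact h.elim i
  · right
    obtain ⟨i, -, hi⟩ := Finset.exists_max_image Finset.univ (fun i => |x i|) Finset.univ_nonempty
    refine ⟨i, ?_⟩
    have h1 : x = ∑ j, EuclideanSpace.single j (x j) := by
      ext j
      simp [Finset.sum_apply, Pi.single_apply]
    calc ‖x‖ = ‖∑ j, EuclideanSpace.single j (x j)‖ := by rw [← h1]
      _ ≤ ∑ j, ‖EuclideanSpace.single j (x j)‖ := norm_sum_le _ _
      _ = ∑ j, |x j| := by simp
      _ ≤ ∑ _j : Fin d, |x i| := Finset.sum_le_sum fun j hj => hi j hj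
      _ = d * |x i| := by simp

/-- The norm is at most `d` times the largest coordinate in absolute value, so finitely many
exponentials of linear forms control `exp (a ‖x‖)`. The summand `1` is what remains when `d = 0`. -/
lemma exp_mul_norm_le (a : ℝ) (ha : 0 ≤ a) (x : Param d) :
    Real.exp (a * ‖x‖) ≤ 1 + ∑ i, (Real.exp (inner ℝ (EuclideanSpace.single i (a * d)) x) +
      Real.exp (inner ℝ (EuclideanSpace.single i (-(a * d))) x)) := by
  have hnn : ∀ i ∈ Finset.univ, 0 ≤ Real.exp (inner ℝ (EuclideanSpace.single i (a * d)) x) +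
      Real.exp (inner ℝ (EuclideanSpace.single i (-(a * d))) x) := fun i _ => by positivity
  rcases norm_le_card_mul_abs_or_eq_zero x with rfl | ⟨i, hi⟩
  · simp
  · have h1 := Finset.single_le_sum hnn (Finset.mem_univ i)
    refine le_trans ?_ (h1.trans (le_add_of_nonneg_left zero_le_one))
    have h2 : a * ‖x‖ ≤ a * d * |x i| := by
      rw [mul_assoc]; exact mul_le_mul_of_nonneg_left hi ha
    simp only [EuclideanSpace.inner_single_left, conj_trivial]
    rcases abs_cases (x i) with ⟨h, -⟩ | ⟨h, -⟩
    · refine le_add_of_le_of_nonneg (Real.exp_le_exp.2 ?_) (Real.exp_nonneg _)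
      rwa [h] at h2
    · refine le_add_of_nonneg_of_le (Real.exp_nonneg _) (Real.exp_le_exp.2 ?_)
      rw [h] at h2; linarith

variable [MeasurableSpace Θ]

/-- `g` is integrable against `exp ⟪η, T⟫`, with a margin that is exponential in `‖T‖`. -/
def HasExpMoment (T : Θ → Param d) (ν : Measure Θ) (η : Param d) (g : Θ → E) : Prop :=
  ∃ ε : ℝ, 0 < ε ∧ Integrable (fun θ => Real.exp (inner ℝ η (T θ) + ε * ‖T θ‖) • g θ) ν

/-- The Laplace type integral `∫ exp ⟪η, T⟫ g dν`. -/
noncomputable def expIntegral (T : Θ → Param d) (ν : Measure Θ) (g : Θ → E) (η : Param d) : E :=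
  ∫ θ, Real.exp (inner ℝ η (T θ)) • g θ ∂ν

variable {T : Θ → Param d} {ν : Measure Θ} {η : Param d} {g : Θ → E}

lemma aestronglyMeasurable_of_exp_smul {f : Θ → ℝ} (hf : Measurable f)
    (h : AEStronglyMeasurable (fun θ => Real.exp (f θ) • g θ) ν) : AEStronglyMeasurable g ν := by
  have hm : Measurable fun θ => Real.exp (-f θ) := by fun_prop
  refine (hm.aestronglyMeasurable.smul h).congr (Eventually.of_forall fun θ => ?_)
  simp [smul_smul, ← Real.exp_add]

lemma HasExpMoment.aestronglyMeasurable (hT : Measurable T) (hg : HasExpMoment T ν η g) :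
    AEStronglyMeasurable g ν := by
  obtain ⟨ε, -, h⟩ := hg
  exact aestronglyMeasurable_of_exp_smul (by fun_prop) h.aestronglyMeasurable

/-- By `exp_mul_norm_le`, integrability at `η` and at the finitely many points `η ± ε d eᵢ` of the
ball already gives the margin `ε`. -/
lemma hasExpMoment_of_eventually (hT : Measurable T)
    (h : ∀ᶠ η' in 𝓝 η, Integrable (fun θ => Real.exp (inner ℝ η' (T θ)) • g θ) ν) :
    HasExpMoment T ν η g := by
  obtain ⟨r, hr, hball⟩ := Metric.eventually_nhds_iff_ball.1 h
  have hd : (0 : ℝ) < d + 1 := by positivity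
  -- Chosen so that the shifts `ε * d` stay below `r`; the `+ 1` keeps the denominator nonzero when
  -- `d = 0`.
  set ε : ℝ := r / (2 * (d + 1)) with hε
  have hε0 : 0 < ε := by positivity
  have hεd : ε * d < r := by
    have : ε * (2 * (d + 1)) = r := by rw [hε]; field_simp
    nlinarith
  have key : ∀ (s : ℝ) (i : Fin d), |s| < r → Integrable
      (fun θ => Real.exp (inner ℝ (EuclideanSpace.single i s) (T θ)) •
        Real.exp (inner ℝ η (T θ)) • g θ) ν := by
    intro s i hs
    refine (hball (η + EuclideanSpace.single i s) (by simpa using hs)).congr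
      (Eventually.of_forall fun θ => ?_)
    simp only [smul_smul, inner_add_left, Real.exp_add]
    rw [mul_comm]
  have h0 := hball η (Metric.mem_ball_self hr)
  have hsum : Integrable (fun θ => Real.exp (inner ℝ η (T θ)) • g θ +
      ∑ i, (Real.exp (inner ℝ (EuclideanSpace.single i (ε * d)) (T θ)) •
        Real.exp (inner ℝ η (T θ)) • g θ +
        Real.exp (inner ℝ (EuclideanSpace.single i (-(ε * d))) (T θ)) •
        Real.exp (inner ℝ η (T θ)) • g θ)) ν := by
    refine h0.add (integrable_finsetSum _ fun i _ => (key _ i ?_).add (key _ i ?_))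
    · rwa [abs_of_nonneg (by positivity)]
    · rwa [abs_neg, abs_of_nonneg (by positivity)]
  refine ⟨ε, hε0, hsum.mono ?_ (Eventually.of_forall fun θ => ?_)⟩
  · have hm : Measurable fun θ => Real.exp (ε * ‖T θ‖) := by fun_prop
    refine (hm.aestronglyMeasurable.smul h0.aestronglyMeasurable).congr
      (Eventually.of_forall fun θ => ?_)
    simp only [smul_smul, Pi.smul_apply', Real.exp_add]
    rw [mul_comm]
  · have h1 := exp_mul_norm_le ε hε0.le (T θ)
    set x := Real.exp (inner ℝ η (T θ)) • g θ with hx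
    have h2 : x + ∑ i, (Real.exp (inner ℝ (EuclideanSpace.single i (ε * d)) (T θ)) • x +
        Real.exp (inner ℝ (EuclideanSpace.single i (-(ε * d))) (T θ)) • x) =
        (1 + ∑ i, (Real.exp (inner ℝ (EuclideanSpace.single i (ε * d)) (T θ)) +
          Real.exp (inner ℝ (EuclideanSpace.single i (-(ε * d))) (T θ)))) • x := by
      rw [add_smul, one_smul, Finset.sum_smul]
      simp only [add_smul]
    rw [h2, add_comm, Real.exp_add, mul_smul, ← hx, norm_smul _ x,
      norm_smul _ x, Real.norm_of_nonneg (Real.exp_nonneg _)]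
    exact mul_le_mul_of_nonneg_right (h1.trans (Real.le_norm_self _)) (norm_nonneg x)

/-- Half of the margin absorbs the factor `1 + ‖T‖`, and the other half survives. -/
lemma HasExpMoment.of_norm_le (hT : Measurable T) (hg : HasExpMoment T ν η g) {g' : Θ → E'}
    (hm : AEStronglyMeasurable g' ν) {C : ℝ} (hC : 0 ≤ C)
    (h : ∀ θ, ‖g' θ‖ ≤ C * (1 + ‖T θ‖) * ‖g θ‖) : HasExpMoment T ν η g' := by
  obtain ⟨ε, hε, hi⟩ := hg
  refine ⟨ε / 2, half_pos hε, (hi.norm.const_mul (C * (1 + 2 / ε))).mono' ?_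
    (Eventually.of_forall fun θ => ?_)⟩
  · have hm' : Measurable fun θ => Real.exp (inner ℝ η (T θ) + ε / 2 * ‖T θ‖) := by fun_prop
    exact hm'.aestronglyMeasurable.smul hm
  · rw [norm_smul, norm_smul, Real.norm_of_nonneg (Real.exp_nonneg _),
      Real.norm_of_nonneg (Real.exp_nonneg _)]
    have h1 : 1 + ‖T θ‖ ≤ (1 + 2 / ε) * Real.exp (ε / 2 * ‖T θ‖) := by
      have h2 := Real.add_one_le_exp (ε / 2 * ‖T θ‖)
      have h3 : (1 + 2 / ε) * (ε / 2 * ‖T θ‖ + 1) =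
          1 + ‖T θ‖ + (2 / ε + ε / 2 * ‖T θ‖) := by field_simp; ring
      have h4 : 0 ≤ 2 / ε + ε / 2 * ‖T θ‖ := by positivity
      have h5 := mul_le_mul_of_nonneg_left h2 (show 0 ≤ 1 + 2 / ε by positivity)
      linarith
    have h6 : Real.exp (inner ℝ η (T θ) + ε * ‖T θ‖) =
        Real.exp (inner ℝ η (T θ) + ε / 2 * ‖T θ‖) * Real.exp (ε / 2 * ‖T θ‖) := by
      rw [← Real.exp_add]; congr 1; ring
    calc Real.exp (inner ℝ η (T θ) + ε / 2 * ‖T θ‖) * ‖g' θ‖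
        ≤ Real.exp (inner ℝ η (T θ) + ε / 2 * ‖T θ‖) *
          (C * ((1 + 2 / ε) * Real.exp (ε / 2 * ‖T θ‖)) * ‖g θ‖) := by
          gcongr
          exact (h θ).trans (by gcongr)
      _ = _ := by rw [h6]; ring

lemma HasExpMoment.statTensor (hT : Measurable T) (hg : HasExpMoment T ν η g) :
    HasExpMoment T ν η (statTensor T g) := by
  refine hg.of_norm_le hT ?_ zero_le_one fun θ => ?_
  · have h1 : AEStronglyMeasurable (fun θ => innerSL ℝ (T θ)) ν :=
      (innerSL ℝ).continuous.comp_aestronglyMeasurable hT.aestronglyMeasurable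
    exact (ContinuousLinearMap.smulRightL ℝ (Param d) E).aestronglyMeasurable_comp₂ h1
      (hg.aestronglyMeasurable hT)
  · rw [norm_statTensor, one_mul]
    gcongr
    linarith

/-- By Cauchy–Schwarz, moving the parameter by `‖η' - η‖` costs at most that much of the margin. -/
lemma HasExpMoment.integrable_of_dist_le (hT : Measurable T) {ε : ℝ}
    (hg : Integrable (fun θ => Real.exp (inner ℝ η (T θ) + ε * ‖T θ‖) • g θ) ν)
    {η' : Param d} {δ : ℝ} (hd : ‖η' - η‖ + δ ≤ ε) :
    Integrable (fun θ => Real.exp (inner ℝ η' (T θ) + δ * ‖T θ‖) • g θ) ν := by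
  have hgm : AEStronglyMeasurable g ν :=
    aestronglyMeasurable_of_exp_smul (by fun_prop) hg.aestronglyMeasurable
  refine hg.mono ?_ (Eventually.of_forall fun θ => ?_)
  · have hm' : Measurable fun θ => Real.exp (inner ℝ η' (T θ) + δ * ‖T θ‖) := by fun_prop
    exact hm'.aestronglyMeasurable.smul hgm
  · rw [norm_smul, norm_smul, Real.norm_of_nonneg (Real.exp_nonneg _),
      Real.norm_of_nonneg (Real.exp_nonneg _)]
    refine mul_le_mul_of_nonneg_right (Real.exp_le_exp.2 ?_) (norm_nonneg _)
    have h1 : inner ℝ η' (T θ) = inner ℝ η (T θ) + inner ℝ (η' - η) (T θ) := by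
      rw [← inner_add_left]; congr 1; abel
    have h2 := real_inner_le_norm (η' - η) (T θ)
    have h3 := mul_le_mul_of_nonneg_right hd (norm_nonneg (T θ))
    linarith

lemma HasExpMoment.eventually (hT : Measurable T) (hg : HasExpMoment T ν η g) :
    ∀ᶠ η' in 𝓝 η, HasExpMoment T ν η' g := by
  obtain ⟨ε, hε, hi⟩ := hg
  filter_upwards [Metric.ball_mem_nhds η (half_pos hε)] with η' h
  refine ⟨ε / 2, half_pos hε, integrable_of_dist_le hT hi ?_⟩
  rw [Metric.mem_ball, dist_eq_norm] at h
  linarith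

lemma HasExpMoment.integrable (hT : Measurable T) (hg : HasExpMoment T ν η g) :
    Integrable (fun θ => Real.exp (inner ℝ η (T θ)) • g θ) ν := by
  obtain ⟨ε, hε, hi⟩ := hg
  have := integrable_of_dist_le (η' := η) (δ := 0) hT hi (by simpa using hε.le)
  simpa using this

/-- On the ball whose radius is the margin of the tensor `T ⊗ g`, the integrand at `η` with that
margin dominates all derivatives of the integrand. -/
lemma HasExpMoment.hasFDerivAt (hT : Measurable T) (hg : HasExpMoment T ν η g) :
    HasFDerivAt (expIntegral T ν g) (expIntegral T ν (SPEP.statTensor T g) η) η := by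
  have hgm := hg.aestronglyMeasurable hT
  have hst := hg.statTensor hT
  have hint := hg.integrable hT
  obtain ⟨ε, hε, hi⟩ := hst
  refine hasFDerivAt_integral_of_dominated_of_fderiv_le (𝕜 := ℝ)
    (F := fun η' θ => Real.exp (inner ℝ η' (T θ)) • g θ)
    (F' := fun η' θ => Real.exp (inner ℝ η' (T θ)) • SPEP.statTensor T g θ)
    (bound := fun θ => ‖Real.exp (inner ℝ η (T θ) + ε * ‖T θ‖) • SPEP.statTensor T g θ‖)
    (Metric.ball_mem_nhds η hε) ?_ hint ?_ ?_ hi.norm ?_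
  · refine Eventually.of_forall fun η' => ?_
    have hm' : Measurable fun θ => Real.exp (inner ℝ η' (T θ)) := by fun_prop
    exact hm'.aestronglyMeasurable.smul hgm
  · exact ((hg.statTensor hT).integrable hT).aestronglyMeasurable
  · refine Eventually.of_forall fun θ η' hη' => ?_
    rw [norm_smul, norm_smul, Real.norm_of_nonneg (Real.exp_nonneg _),
      Real.norm_of_nonneg (Real.exp_nonneg _)]
    refine mul_le_mul_of_nonneg_right (Real.exp_le_exp.2 ?_) (norm_nonneg _)
    have h1 : inner ℝ η' (T θ) = inner ℝ η (T θ) + inner ℝ (η' - η) (T θ) := by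
      rw [← inner_add_left]; congr 1; abel
    rw [Metric.mem_ball, dist_eq_norm] at hη'
    have h2 := real_inner_le_norm (η' - η) (T θ)
    have h3 := mul_le_mul_of_nonneg_right hη'.le (norm_nonneg (T θ))
    linarith
  · refine Eventually.of_forall fun θ η' _ => ?_
    have h1 : HasFDerivAt (fun η' : Param d => inner ℝ η' (T θ)) (innerSL ℝ (T θ)) η' := by
      refine ((innerSL ℝ (T θ)).hasFDerivAt (x := η')).congr_of_eventuallyEq ?_
      exact Eventually.of_forall fun x => by simp [real_inner_comm]
    refine (h1.exp.smul_const (g θ)).congr_fderiv ?_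
    ext v
    simp [statTensor_apply, smul_smul]

/-- The derivative is an integral of the same kind, with `T ⊗ g` in place of `g`, hence itself
differentiable and so continuous. Strictness is needed for the inverse function theorem. -/
lemma HasExpMoment.hasStrictFDerivAt (hT : Measurable T) (hg : HasExpMoment T ν η g) :
    HasStrictFDerivAt (expIntegral T ν g) (expIntegral T ν (SPEP.statTensor T g) η) η :=
  hasStrictFDerivAt_of_hasFDerivAt_of_continuousAt
    ((hg.eventually hT).mono fun _ h => h.hasFDerivAt hT)
    ((hg.statTensor hT).hasFDerivAt hT).continuousAt

end SPEP

/-! ### Expectations in the natural parameter, Fisher information and identifiability. -/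

namespace SPEP

variable {Θ : Type*} {d : ℕ} [MeasurableSpace Θ]
  {E : Type*} [NormedAddCommGroup E] [NormedSpace ℝ E]
  {T : Θ → Param d} {ν : Measure Θ} {η : Param d} {g : Θ → E}

/-- The expectation `E_{q_η} [g]`. -/
noncomputable def expectation (T : Θ → Param d) (ν : Measure Θ) (g : Θ → E) (η : Param d) : E :=
  ∫ θ, density T ν η θ • g θ ∂ν

/-- The linear map `v ↦ E_{q_η} [⟪T - μ_η, v⟫ g]`. -/
noncomputable def covariance (T : Θ → Param d) (ν : Measure Θ) (g : Θ → E) (η : Param d) :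
    Param d →L[ℝ] E :=
  expectation T ν (statTensor (fun θ => T θ - meanParam T ν η) g) η

lemma partition_eq_expIntegral (T : Θ → Param d) (ν : Measure Θ) :
    partition T ν = expIntegral T ν (fun _ => (1 : ℝ)) := by
  ext η
  simp [partition, expIntegral]

lemma partition_pos [NeZero ν] (hη : η ∈ natDomain T ν) : 0 < partition T ν η :=
  integral_exp_pos hη

lemma density_eq [NeZero ν] (hη : η ∈ natDomain T ν) (θ : Θ) :
    density T ν η θ = (partition T ν η)⁻¹ * Real.exp (inner ℝ η (T θ)) := by
  rw [density, Real.exp_sub, Real.exp_log (partition_pos hη), div_eq_inv_mul]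

lemma density_pos (θ : Θ) : 0 < density T ν η θ := Real.exp_pos _

lemma density_eq_const_mul (θ : Θ) : density T ν η θ =
    Real.exp (-Real.log (partition T ν η)) * Real.exp (inner ℝ η (T θ)) := by
  rw [density, ← Real.exp_add]; congr 1; ring

lemma integrable_density_smul_iff :
    Integrable (fun θ => density T ν η θ • g θ) ν ↔
      Integrable (fun θ => Real.exp (inner ℝ η (T θ)) • g θ) ν := by
  simp only [density_eq_const_mul, mul_smul]
  exact integrable_fun_smul_iff (Real.exp_ne_zero _) _

lemma expectation_eq [NeZero ν] (hη : η ∈ natDomain T ν) (g : Θ → E) :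
    expectation T ν g η = (partition T ν η)⁻¹ • expIntegral T ν g η := by
  simp only [expectation, density_eq hη, expIntegral, mul_smul, integral_smul]

lemma integrable_density (hη : η ∈ natDomain T ν) : Integrable (density T ν η) ν := by
  have := (integrable_density_smul_iff (T := T) (ν := ν) (η := η) (g := fun _ => (1 : ℝ))).2
    (by simpa [natDomain] using hη)
  simpa using this

lemma integral_density [NeZero ν] (hη : η ∈ natDomain T ν) : ∫ θ, density T ν η θ ∂ν = 1 := by
  simp only [density_eq hη, integral_const_mul]
  exact inv_mul_cancel₀ (partition_pos hη).ne'

lemma hasExpMoment_one (hT : Measurable T) (hη : η ∈ interior (natDomain T ν)) :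
    HasExpMoment T ν η (fun _ => (1 : ℝ)) := by
  refine hasExpMoment_of_eventually hT ?_
  filter_upwards [mem_interior_iff_mem_nhds.1 hη] with η' h
  simpa [natDomain] using h

lemma hasExpMoment_stat (hT : Measurable T) (hη : η ∈ interior (natDomain T ν)) :
    HasExpMoment T ν η T :=
  (hasExpMoment_one hT hη).of_norm_le hT hT.aestronglyMeasurable zero_le_one
    fun θ => by simp

lemma HasExpMoment.integrable_density_smul (hT : Measurable T) (hg : HasExpMoment T ν η g) :
    Integrable (fun θ => density T ν η θ • g θ) ν :=
  integrable_density_smul_iff.2 (hg.integrable hT)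

lemma HasExpMoment.integrable_density_inner_smul (hT : Measurable T) (hg : HasExpMoment T ν η g)
    (v : Param d) : Integrable (fun θ => density T ν η θ • inner ℝ (T θ) v • g θ) ν :=
  ((hg.statTensor hT).integrable_density_smul hT).apply_continuousLinearMap v

lemma HasExpMoment.integrable_density_statTensor_sub (hT : Measurable T)
    (hg : HasExpMoment T ν η g) (μ : Param d) :
    Integrable (fun θ => density T ν η θ • SPEP.statTensor (fun θ => T θ - μ) g θ) ν := by
  simp only [statTensor_sub, smul_sub]
  refine ((hg.statTensor hT).integrable_density_smul hT).sub ?_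
  have := ((ContinuousLinearMap.smulRightL ℝ (Param d) E (innerSL ℝ μ)).integrable_comp
    (hg.integrable_density_smul hT))
  refine this.congr (Eventually.of_forall fun θ => ?_)
  ext v
  simp [smul_smul]

lemma covariance_apply (hT : Measurable T) (hg : HasExpMoment T ν η g) (v : Param d) :
    covariance T ν g η v =
      ∫ θ, density T ν η θ • inner ℝ (T θ - meanParam T ν η) v • g θ ∂ν := by
  rw [covariance, expectation,
    ContinuousLinearMap.integral_apply (hg.integrable_density_statTensor_sub hT _)]
  rfl

lemma inner_meanParam (hT : Measurable T) (hη : η ∈ interior (natDomain T ν)) (v : Param d) :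
    inner ℝ (meanParam T ν η) v = ∫ θ, density T ν η θ * inner ℝ (T θ) v ∂ν := by
  rw [real_inner_comm, meanParam,
    ← integral_inner ((hasExpMoment_stat hT hη).integrable_density_smul hT)]
  simp [inner_smul_right, real_inner_comm]

lemma covariance_apply_eq_sub (hT : Measurable T) (hg : HasExpMoment T ν η g) (v : Param d) :
    covariance T ν g η v = ∫ θ, density T ν η θ • inner ℝ (T θ) v • g θ ∂ν -
      inner ℝ (meanParam T ν η) v • expectation T ν g η := by
  rw [covariance_apply hT hg, expectation, ← integral_smul, ← integral_sub
    (hg.integrable_density_inner_smul hT v) ((hg.integrable_density_smul hT).fun_smul _)]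
  congr 1 with θ
  rw [inner_sub_left, sub_smul, smul_sub, smul_comm (inner ℝ (meanParam T ν η) v)]

/-- The expectation of `g` is differentiable in the natural parameter, and its derivative is the
covariance with the sufficient statistic. -/
theorem hasStrictFDerivAt_expectation [NeZero ν] (hT : Measurable T)
    (hη : η ∈ interior (natDomain T ν)) (hg : HasExpMoment T ν η g) :
    HasStrictFDerivAt (expectation T ν g) (covariance T ν g η) η := by
  have hη' := interior_subset hη
  have hZ := (hasExpMoment_one hT hη).hasStrictFDerivAt hT
  rw [← partition_eq_expIntegral] at hZ
  have h := ((hasStrictDerivAt_inv (partition_pos hη').ne').comp_hasStrictFDerivAt η hZ).fun_smul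
    (hg.hasStrictFDerivAt hT)
  refine (h.congr_fderiv ?_).congr_of_eventuallyEq ?_
  · ext v
    -- The derivative of the partition function `Z` is `Z μ`; in the product rule for `Z⁻¹ ∫ exp ⟪η,
    -- T⟫ g` it produces the centring term of the covariance.
    have h1 : expIntegral T ν (SPEP.statTensor T fun _ => (1 : ℝ)) η v =
        partition T ν η * inner ℝ (meanParam T ν η) v := by
      rw [inner_meanParam hT hη, ← integral_const_mul, expIntegral,
        ContinuousLinearMap.integral_apply
          (((hasExpMoment_one hT hη).statTensor hT).integrable hT)]
      congr 1 with θ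
      rw [density_eq hη', ← mul_assoc, ← mul_assoc, mul_inv_cancel₀ (partition_pos hη').ne']
      simp [statTensor_apply]
    have h2 : (partition T ν η)⁻¹ • expIntegral T ν (SPEP.statTensor T g) η v =
        ∫ θ, density T ν η θ • inner ℝ (T θ) v • g θ ∂ν := by
      rw [expIntegral, ContinuousLinearMap.integral_apply ((hg.statTensor hT).integrable hT),
        ← integral_smul]
      congr 1 with θ
      rw [density_eq hη', mul_smul]
      rfl
    rw [covariance_apply_eq_sub hT hg, ← h2, expectation_eq hη']
    simp only [add_apply, smul_apply,
      ContinuousLinearMap.smulRight_apply, h1, sub_eq_add_neg, ← neg_smul, smul_smul, smul_eq_mul]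
    congr 2
    have := (partition_pos hη').ne'
    field_simp
  -- The quotient formula is available only where the partition function is positive, which holds
  -- near `η`.
  · filter_upwards [mem_interior_iff_mem_nhds.1 hη] with η₁ h₁
    rw [expectation_eq h₁]
    rfl

/-- The vector `E_{q_η} [f (T - μ_η)]`. -/
noncomputable def covVec (T : Θ → Param d) (ν : Measure Θ) (f : Θ → ℝ) (η : Param d) : Param d :=
  expectation T ν (fun θ => f θ • (T θ - meanParam T ν η)) η

lemma HasExpMoment.integrable_covVec (hT : Measurable T) {f : Θ → ℝ}
    (hf : HasExpMoment T ν η f) (μ : Param d) :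
    Integrable (fun θ => density T ν η θ • f θ • (T θ - μ)) ν := by
  have h1 := (hf.of_norm_le (g' := fun θ => f θ • T θ) hT
    ((hf.aestronglyMeasurable hT).smul hT.aestronglyMeasurable) zero_le_one fun θ => by
      rw [norm_smul, mul_comm, one_mul]; gcongr; linarith).integrable_density_smul hT
  have h2 := (hf.integrable_density_smul hT).smul_const μ
  refine (h1.sub h2).congr (Eventually.of_forall fun θ => ?_)
  simp [smul_sub, smul_smul]

lemma covariance_apply_eq_inner (hT : Measurable T) {f : Θ → ℝ} (hf : HasExpMoment T ν η f)
    (v : Param d) : covariance T ν f η v = inner ℝ (covVec T ν f η) v := by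
  rw [covariance_apply hT hf, real_inner_comm, covVec, expectation,
    ← integral_inner (hf.integrable_covVec hT _)]
  congr 1 with θ
  simp only [inner_smul_right, smul_eq_mul, real_inner_comm v]
  ring

lemma integral_density_smul_stat_sub [NeZero ν] (hT : Measurable T)
    (hη : η ∈ interior (natDomain T ν)) :
    ∫ θ, density T ν η θ • (T θ - meanParam T ν η) ∂ν = 0 := by
  simp only [smul_sub]
  rw [integral_sub ((hasExpMoment_stat hT hη).integrable_density_smul hT)
    ((integrable_density (interior_subset hη)).smul_const _), integral_smul_const,
    integral_density (interior_subset hη), one_smul]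
  exact sub_self _

/-- Centring the second factor as well is free, because `T - μ` has mean zero. The symmetric form
shows that the Fisher information is self-adjoint and positive. -/
lemma inner_covariance_stat [NeZero ν] (hT : Measurable T) (hη : η ∈ interior (natDomain T ν))
    (u v : Param d) : inner ℝ (covariance T ν T η u) v = ∫ θ, density T ν η θ *
      (inner ℝ (T θ - meanParam T ν η) u * inner ℝ (T θ - meanParam T ν η) v) ∂ν := by
  have hs := hasExpMoment_stat hT hη
  have hI : Integrable (fun θ => density T ν η θ • inner ℝ (T θ - meanParam T ν η) u • T θ) ν :=
    (hs.integrable_density_statTensor_sub hT (meanParam T ν η)).apply_continuousLinearMap u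
  have h0 := integral_density_smul_stat_sub hT hη
  have hI0 : Integrable (fun θ => density T ν η θ • (T θ - meanParam T ν η)) ν := by
    simp only [smul_sub]
    exact (hs.integrable_density_smul hT).sub
      ((integrable_density (interior_subset hη)).smul_const _)
  have h1 : ∫ θ, density T ν η θ * inner ℝ (T θ - meanParam T ν η) u ∂ν = 0 := by
    have := integral_inner (𝕜 := ℝ) hI0 u
    rw [h0, inner_zero_right] at this
    rw [← this]
    congr 1 with θ
    rw [inner_smul_right, real_inner_comm]
  have hI1 : Integrable (fun θ => density T ν η θ * inner ℝ (T θ - meanParam T ν η) u) ν := by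
    refine (hI0.const_inner (𝕜 := ℝ) u).congr (Eventually.of_forall fun θ => ?_)
    simp only [inner_smul_right, real_inner_comm]
  rw [covariance_apply hT hs, real_inner_comm, ← integral_inner hI]
  have h2 : ∫ θ, density T ν η θ * inner ℝ (T θ - meanParam T ν η) u *
      inner ℝ (meanParam T ν η) v ∂ν = 0 := by
    rw [integral_mul_const, h1, zero_mul]
  rw [← sub_zero (∫ θ, inner ℝ v _ ∂ν), ← h2,
    ← integral_sub (hI.const_inner (𝕜 := ℝ) v) (hI1.mul_const _)]
  congr 1 with θ
  simp only [inner_smul_right, inner_sub_left, inner_sub_right, real_inner_comm v]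
  ring

lemma inner_covariance_stat_comm [NeZero ν] (hT : Measurable T)
    (hη : η ∈ interior (natDomain T ν)) (u v : Param d) :
    inner ℝ (covariance T ν T η u) v = inner ℝ u (covariance T ν T η v) := by
  rw [← real_inner_comm u, inner_covariance_stat hT hη, inner_covariance_stat hT hη]
  simp only [mul_comm (inner ℝ _ u)]

/-- The quadratic form at `u` is the variance of `⟪T, u⟫`. If it vanishes, `⟪T, u⟫` is a.e.
constant, and minimality gives `u = 0`. -/
lemma covariance_stat_injective [NeZero ν] (hT : Measurable T) (hmin : IsMinimal T ν)
    (hη : η ∈ interior (natDomain T ν)) : Function.Injective (covariance T ν T η) := by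
  refine (injective_iff_map_eq_zero _).2 fun u hu => ?_
  have hs := hasExpMoment_stat hT hη
  have h1 := inner_covariance_stat hT hη u u
  rw [hu, inner_zero_left] at h1
  have hI : Integrable (fun θ => density T ν η θ *
      (inner ℝ (T θ - meanParam T ν η) u * inner ℝ (T θ - meanParam T ν η) u)) ν := by
    have hg : HasExpMoment T ν η (fun θ => inner ℝ (T θ - meanParam T ν η) u) := by
      refine (hasExpMoment_one hT hη).of_norm_le hT
        (C := (1 + ‖meanParam T ν η‖) * ‖u‖) (by fun_prop) (by positivity) fun θ => ?_
      have h2 := norm_inner_le_norm (𝕜 := ℝ) (T θ - meanParam T ν η) u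
      have h3 := mul_le_mul_of_nonneg_right (norm_sub_le (T θ) (meanParam T ν η)) (norm_nonneg u)
      have h4 : 0 ≤ (1 + ‖meanParam T ν η‖ * ‖T θ‖) * ‖u‖ := by positivity
      rw [norm_one, mul_one]
      linarith
    have := (hg.integrable_density_statTensor_sub hT
      (meanParam T ν η)).apply_continuousLinearMap u
    exact this
  have h2 := (integral_eq_zero_iff_of_nonneg
    (fun θ => mul_nonneg (density_pos θ).le (mul_self_nonneg _)) hI).1 h1.symm
  refine hmin u ⟨inner ℝ u (meanParam T ν η), h2.mono fun θ h => ?_⟩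
  have h3 := (mul_eq_zero.1 h).resolve_left (density_pos θ).ne'
  rw [mul_self_eq_zero, inner_sub_left, sub_eq_zero] at h3
  rwa [real_inner_comm, real_inner_comm _ u]

/-- The Fisher information at an interior point is invertible. -/
lemma exists_equiv_eq_covariance_stat [NeZero ν] (hT : Measurable T) (hmin : IsMinimal T ν)
    (hη : η ∈ interior (natDomain T ν)) :
    ∃ K : Param d ≃L[ℝ] Param d, (K : Param d →L[ℝ] Param d) = covariance T ν T η :=
  ⟨(LinearEquiv.ofInjectiveEndo (covariance T ν T η : Param d →ₗ[ℝ] Param d)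
    (covariance_stat_injective hT hmin hη)).toContinuousLinearEquiv, by ext; rfl⟩

/-- A natural parameter is determined by its mean parameter, even at the boundary. -/
theorem eq_of_meanParam_eq [NeZero ν] (hmin : IsMinimal T ν) {η₁ η₂ : Param d}
    (h₁ : η₁ ∈ natDomain T ν) (h₂ : η₂ ∈ natDomain T ν)
    (hi₁ : Integrable (fun θ => density T ν η₁ θ • T θ) ν)
    (hi₂ : Integrable (fun θ => density T ν η₂ θ • T θ) ν)
    (h : meanParam T ν η₁ = meanParam T ν η₂) : η₁ = η₂ := by
  set a₁ : Θ → ℝ := fun θ => inner ℝ η₁ (T θ) - Real.log (partition T ν η₁) with ha₁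
  set a₂ : Θ → ℝ := fun θ => inner ℝ η₂ (T θ) - Real.log (partition T ν η₂) with ha₂
  set c := Real.log (partition T ν η₁) - Real.log (partition T ν η₂) with hc
  have hsub : ∀ θ, a₁ θ - a₂ θ = inner ℝ (η₁ - η₂) (T θ) - c := fun θ => by
    rw [ha₁, ha₂, hc, inner_sub_left]; ring
  have hI := (hi₁.sub hi₂).const_inner (𝕜 := ℝ) (η₁ - η₂)
  have hJ := ((integrable_density h₁).sub (integrable_density h₂)).const_mul c
  have hfun : (fun θ => (density T ν η₁ θ - density T ν η₂ θ) * (a₁ θ - a₂ θ)) =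
      fun θ => inner ℝ (η₁ - η₂)
        (((fun θ => density T ν η₁ θ • T θ) - fun θ => density T ν η₂ θ • T θ) θ) -
        c * (density T ν η₁ - density T ν η₂) θ := by
    ext θ
    rw [hsub]
    simp only [Pi.sub_apply, ← sub_smul, inner_smul_right]
    ring
  -- This integral is the symmetrised Kullback–Leibler divergence of the two densities. It equals
  -- `⟪η₁ - η₂, μ₁ - μ₂⟫ = 0`, while its integrand is nonnegative since `exp` is monotone.
  have h0 : ∫ θ, (density T ν η₁ θ - density T ν η₂ θ) * (a₁ θ - a₂ θ) ∂ν = 0 := by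
    rw [hfun, integral_sub hI hJ, integral_inner (hi₁.sub hi₂), integral_const_mul,
      integral_sub' hi₁ hi₂, integral_sub' (integrable_density h₁) (integrable_density h₂),
      integral_density h₁, integral_density h₂]
    change inner ℝ (η₁ - η₂) (meanParam T ν η₁ - meanParam T ν η₂) - _ = _
    rw [h]; simp
  have hnn : ∀ θ, 0 ≤ (density T ν η₁ θ - density T ν η₂ θ) * (a₁ θ - a₂ θ) := fun θ => by
    change 0 ≤ (Real.exp (a₁ θ) - Real.exp (a₂ θ)) * (a₁ θ - a₂ θ)
    rcases le_total (a₁ θ) (a₂ θ) with hle | hle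
    · exact mul_nonneg_of_nonpos_of_nonpos (sub_nonpos.2 (Real.exp_le_exp.2 hle))
        (sub_nonpos.2 hle)
    · exact mul_nonneg (sub_nonneg.2 (Real.exp_le_exp.2 hle)) (sub_nonneg.2 hle)
  have h3 := (integral_eq_zero_iff_of_nonneg hnn (hfun ▸ hI.sub hJ)).1 h0
  refine sub_eq_zero.1 (hmin _ ⟨c, h3.mono fun θ hθ => ?_⟩)
  have h4 : a₁ θ = a₂ θ := by
    rcases mul_eq_zero.1 hθ with h5 | h5
    · exact Real.exp_injective (sub_eq_zero.1 h5)
    · exact sub_eq_zero.1 h5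
  have := hsub θ
  rw [h4] at this
  linarith

end SPEP

/-! ### The mean parametrisation and the natural gradient. -/

namespace SPEP

variable {Θ : Type*} {d : ℕ} [MeasurableSpace Θ]
  {E : Type*} [NormedAddCommGroup E] [NormedSpace ℝ E]
  {T : Θ → Param d} {ν : Measure Θ} {η : Param d} {g : Θ → E}

lemma natOfMean_meanParam [NeZero ν] (hT : Measurable T) (hmin : IsMinimal T ν)
    (hη : η ∈ interior (natDomain T ν)) : natOfMean T ν (meanParam T ν η) = η :=
  Set.InjOn.leftInvOn_invFunOn (fun _ h₁ _ h₂ h => eq_of_meanParam_eq hmin (interior_subset h₁)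
    (interior_subset h₂) ((hasExpMoment_stat hT h₁).integrable_density_smul hT)
    ((hasExpMoment_stat hT h₂).integrable_density_smul hT) h) hη

lemma eventually_mem_interior (hη : η ∈ interior (natDomain T ν)) :
    ∀ᶠ η' in 𝓝 η, η' ∈ interior (natDomain T ν) :=
  isOpen_interior.mem_nhds hη

lemma hasStrictFDerivAt_meanParam [NeZero ν] (hT : Measurable T)
    (hη : η ∈ interior (natDomain T ν)) {K : Param d ≃L[ℝ] Param d}
    (hK : (K : Param d →L[ℝ] Param d) = covariance T ν T η) :
    HasStrictFDerivAt (meanParam T ν) (K : Param d →L[ℝ] Param d) η :=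
  hK ▸ hasStrictFDerivAt_expectation hT hη (hasExpMoment_stat hT hη)

/-- A left inverse near `η` agrees near `μ_η` with the local inverse of the inverse function
theorem. -/
lemma hasStrictFDerivAt_natOfMean [NeZero ν] (hT : Measurable T) (hmin : IsMinimal T ν)
    (hη : η ∈ interior (natDomain T ν)) {K : Param d ≃L[ℝ] Param d}
    (hK : (K : Param d →L[ℝ] Param d) = covariance T ν T η) :
    HasStrictFDerivAt (natOfMean T ν) (K.symm : Param d →L[ℝ] Param d) (meanParam T ν η) :=
  (hasStrictFDerivAt_meanParam hT hη hK).to_local_left_inverse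
    ((eventually_mem_interior hη).mono fun _ h => natOfMean_meanParam hT hmin h)

/-- Near the mean parameter of an interior point, `natOfMean` is a right inverse of the mean
parameter map, with values in the interior of the natural parameter space. -/
lemma eventually_natOfMean [NeZero ν] (hT : Measurable T) (hmin : IsMinimal T ν)
    (hη : η ∈ interior (natDomain T ν)) : ∀ᶠ m in 𝓝 (meanParam T ν η),
      natOfMean T ν m ∈ interior (natDomain T ν) ∧ meanParam T ν (natOfMean T ν m) = m := by
  obtain ⟨K, hK⟩ := exists_equiv_eq_covariance_stat hT hmin hη
  -- The mean parameter map sends `𝓝 η` onto `𝓝 μ_η`, so the claim can be checked at points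
  -- `meanParam T ν η'`, where the left inverse property applies.
  rw [← (hasStrictFDerivAt_meanParam hT hη hK).map_nhds_eq_of_equiv, eventually_map]
  filter_upwards [eventually_mem_interior hη] with η' h
  rw [natOfMean_meanParam hT hmin h]
  exact ⟨h, rfl⟩

lemma hasFDerivAt_meanExpectation [NeZero ν] (hT : Measurable T) (hmin : IsMinimal T ν)
    (hη : η ∈ interior (natDomain T ν)) {f : Θ → ℝ} (hf : HasExpMoment T ν η f)
    {K : Param d ≃L[ℝ] Param d} (hK : (K : Param d →L[ℝ] Param d) = covariance T ν T η) :
    HasFDerivAt (meanExpectation T ν f) (covariance T ν f η ∘L (K.symm : Param d →L[ℝ] Param d))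
      (meanParam T ν η) := by
  have h : HasFDerivAt (expectation T ν f) (covariance T ν f η)
      (natOfMean T ν (meanParam T ν η)) := by
    rw [natOfMean_meanParam hT hmin hη]
    exact (hasStrictFDerivAt_expectation hT hη hf).hasFDerivAt
  exact h.comp _ (hasStrictFDerivAt_natOfMean hT hmin hη hK).hasFDerivAt

theorem differentiableAt_meanExpectation [NeZero ν] (hT : Measurable T) (hmin : IsMinimal T ν)
    (hη : η ∈ interior (natDomain T ν)) {f : Θ → ℝ} (hf : HasExpMoment T ν η f) :
    DifferentiableAt ℝ (meanExpectation T ν f) (meanParam T ν η) := by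
  obtain ⟨K, hK⟩ := exists_equiv_eq_covariance_stat hT hmin hη
  exact (hasFDerivAt_meanExpectation hT hmin hη hf hK).differentiableAt

/-- The gradient with respect to the mean parameter is the natural gradient. -/
theorem covariance_stat_meanGradient [NeZero ν] (hT : Measurable T) (hmin : IsMinimal T ν)
    (hη : η ∈ interior (natDomain T ν)) {f : Θ → ℝ} (hf : HasExpMoment T ν η f) :
    covariance T ν T η (meanGradient T ν f η) = covVec T ν f η := by
  obtain ⟨K, hK⟩ := exists_equiv_eq_covariance_stat hT hmin hη
  refine ext_inner_right ℝ fun v => ?_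
  rw [inner_covariance_stat_comm hT hη, ← covariance_apply_eq_inner hT hf, meanGradient, gradient,
    InnerProductSpace.toDual_symm_apply, (hasFDerivAt_meanExpectation hT hmin hη hf hK).fderiv,
    ← hK]
  simp

lemma HasExpMoment.sub (hT : Measurable T) {g' : Θ → E} (hg : HasExpMoment T ν η g)
    (hg' : HasExpMoment T ν η g') : HasExpMoment T ν η (fun θ => g θ - g' θ) := by
  refine hasExpMoment_of_eventually hT ?_
  filter_upwards [hg.eventually hT, hg'.eventually hT] with η' h h'
  simp only [smul_sub]
  exact (h.integrable hT).sub (h'.integrable hT)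

lemma HasExpMoment.congr (hg : HasExpMoment T ν η g) {g' : Θ → E} (h : g =ᵐ[ν] g') :
    HasExpMoment T ν η g' := by
  obtain ⟨ε, hε, hi⟩ := hg
  exact ⟨ε, hε, hi.congr (h.mono fun θ hθ => by simp only [hθ])⟩

lemma hasExpMoment_inner_add_const (hT : Measurable T) (hη : η ∈ interior (natDomain T ν))
    (τ : Param d) (b : ℝ) : HasExpMoment T ν η (fun θ => inner ℝ τ (T θ) + b) := by
  refine (hasExpMoment_one hT hη).of_norm_le hT (C := ‖τ‖ + |b|) (by fun_prop) (by positivity)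
    fun θ => ?_
  have h1 := norm_add_le (inner ℝ τ (T θ)) b
  have h2 := norm_inner_le_norm (𝕜 := ℝ) τ (T θ)
  have h3 : 0 ≤ ‖τ‖ + |b| * ‖T θ‖ := by positivity
  rw [Real.norm_eq_abs b] at h1
  rw [norm_one, mul_one]
  linarith

lemma covariance_sub (hT : Measurable T) {g' : Θ → E} (hg : HasExpMoment T ν η g)
    (hg' : HasExpMoment T ν η g') :
    covariance T ν (fun θ => g θ - g' θ) η = covariance T ν g η - covariance T ν g' η := by
  simp only [covariance, expectation]
  rw [← integral_sub (hg.integrable_density_statTensor_sub hT _)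
    (hg'.integrable_density_statTensor_sub hT _)]
  congr 1 with θ v
  simp [statTensor_apply, smul_sub]

lemma covariance_congr {g' : Θ → E} (h : g =ᵐ[ν] g') :
    covariance T ν g η = covariance T ν g' η :=
  integral_congr_ae (h.mono fun θ hθ => by simp only [statTensor, hθ])

/-- Both sides are derivatives of the same function `E_q[⟪τ, T⟫ + b] = ⟪τ, μ⟫ + b`, so uniqueness of
the derivative replaces a computation with integrals. -/
lemma covariance_inner_add_const [NeZero ν] (hT : Measurable T)
    (hη : η ∈ interior (natDomain T ν)) (τ : Param d) (b : ℝ) (v : Param d) :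
    covariance T ν (fun θ => inner ℝ τ (T θ) + b) η v = inner ℝ τ (covariance T ν T η v) := by
  have hs := hasExpMoment_stat hT hη
  have h1 := hasStrictFDerivAt_expectation hT hη (hasExpMoment_inner_add_const hT hη τ b)
  have h2 : HasFDerivAt (fun η' => inner ℝ τ (meanParam T ν η') + b)
      (innerSL ℝ τ ∘L covariance T ν T η) η :=
    (((innerSL ℝ τ).hasFDerivAt).comp η
      (hasStrictFDerivAt_expectation hT hη hs).hasFDerivAt).add_const b
  have h3 : expectation T ν (fun θ => inner ℝ τ (T θ) + b) =ᶠ[𝓝 η]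
      fun η' => inner ℝ τ (meanParam T ν η') + b := by
    filter_upwards [eventually_mem_interior hη] with η' h
    have hi := (hasExpMoment_stat hT h).integrable_density_smul hT
    have hd := integrable_density (interior_subset h)
    rw [meanParam, ← integral_inner hi, expectation]
    simp only [smul_eq_mul, mul_add, inner_smul_right]
    rw [integral_add, integral_mul_const, integral_density (interior_subset h), one_mul]
    · simpa only [inner_smul_right] using hi.const_inner (𝕜 := ℝ) τ
    · exact hd.mul_const b
  rw [(h2.congr_of_eventuallyEq h3).unique h1.hasFDerivAt |>.symm]
  rfl

/-- The covariance of the statistic with the log ratio of a likelihood and a factor of the family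
with natural parameter `τ`. -/
lemma covVec_sub_inner [NeZero ν] (hT : Measurable T) (hmin : IsMinimal T ν)
    (hη : η ∈ interior (natDomain T ν)) {f s : Θ → ℝ} (hf : HasExpMoment T ν η f) (τ : Param d)
    (b : ℝ) (hs : (fun θ => f θ - (inner ℝ τ (T θ) + b)) =ᵐ[ν] s) :
    covVec T ν s η = covariance T ν T η (meanGradient T ν f η - τ) := by
  have hτ := hasExpMoment_inner_add_const hT hη τ b
  refine ext_inner_right ℝ fun v => ?_
  rw [← covariance_apply_eq_inner hT ((hf.sub hT hτ).congr hs), ← covariance_congr hs,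
    covariance_sub hT hf hτ, map_sub, covariance_stat_meanGradient hT hmin hη hf, inner_sub_left,
    inner_covariance_stat_comm hT hη, sub_apply, covariance_inner_add_const hT hη,
    covariance_apply_eq_inner hT hf]

end SPEP

/-! ### Right derivative at zero of integrals of powers. -/

namespace SPEP

section RightDerivative

variable {Θ : Type*} [MeasurableSpace Θ] {E : Type*} [NormedAddCommGroup E] [NormedSpace ℝ E]
  {ν : Measure Θ}

lemma rpow_le_one_add_rpow {x a b : ℝ} (hx : 0 < x) (ha : 0 ≤ a) (hab : a ≤ b) :
    x ^ a ≤ 1 + x ^ b := by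
  have hb := Real.rpow_nonneg hx.le b
  rcases le_total x 1 with h | h
  · linarith [Real.rpow_le_one hx.le h ha]
  · linarith [Real.rpow_le_rpow_of_exponent_le h hab]

/-- The lower bound is `1 + y ≤ exp y`; the upper one is Bernoulli's inequality for `x ^ a` with
exponent `b / a`. The bound does not depend on `a`, so it serves for dominated convergence. -/
lemma abs_rpow_sub_one_div_le {x a b : ℝ} (hx : 0 < x) (ha : 0 < a) (hab : a ≤ b) :
    |a⁻¹ * (x ^ a - 1)| ≤ |Real.log x| + b⁻¹ * x ^ b := by
  have hb : 0 < b := ha.trans_le hab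
  have hxb := Real.rpow_nonneg hx.le b
  rw [abs_le]
  constructor
  · have h1 : Real.log x * a + 1 ≤ x ^ a := by
      rw [Real.rpow_def_of_pos hx]; exact Real.add_one_le_exp _
    have h2 : Real.log x ≤ a⁻¹ * (x ^ a - 1) := by
      rw [le_inv_mul_iff₀ ha]; linarith
    have h3 : 0 ≤ b⁻¹ * x ^ b := by positivity
    linarith [neg_abs_le (Real.log x)]
  · have h1 := one_add_mul_self_le_rpow_one_add (s := x ^ a - 1) (p := b / a)
      (by linarith [Real.rpow_nonneg hx.le a]) ((one_le_div ha).2 hab)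
    rw [add_sub_cancel, ← Real.rpow_mul hx.le, mul_div_cancel₀ _ ha.ne'] at h1
    have h2 : a⁻¹ * (x ^ a - 1) ≤ b⁻¹ * x ^ b := by
      rw [le_inv_mul_iff₀ hb]
      calc b * (a⁻¹ * (x ^ a - 1)) = b / a * (x ^ a - 1) := by rw [div_eq_mul_inv, mul_assoc]
        _ ≤ x ^ b := by linarith
    linarith [abs_nonneg (Real.log x)]

variable {r : Θ → ℝ} {G : Θ → E} {b : ℝ}

lemma integrable_rpow_smul (hr : Measurable r) (hpos : ∀ᵐ θ ∂ν, 0 < r θ) (h0 : Integrable G ν)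
    (hb : Integrable (fun θ => r θ ^ b • G θ) ν) {a : ℝ} (ha : 0 ≤ a) (hab : a ≤ b) :
    Integrable (fun θ => r θ ^ a • G θ) ν := by
  refine (h0.norm.add hb.norm).mono'
    ((hr.pow_const a).aestronglyMeasurable.smul h0.aestronglyMeasurable) ?_
  filter_upwards [hpos] with θ hθ
  simp only [Pi.add_apply, norm_smul, Real.norm_of_nonneg (Real.rpow_nonneg hθ.le _)]
  calc r θ ^ a * ‖G θ‖ ≤ (1 + r θ ^ b) * ‖G θ‖ := by
        gcongr; exact rpow_le_one_add_rpow hθ ha hab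
    _ = _ := by ring

/-- The right derivative at `0` of `α ↦ ∫ r ^ α G`. -/
theorem hasDerivWithinAt_integral_rpow_smul (hr : Measurable r) (hpos : ∀ᵐ θ ∂ν, 0 < r θ)
    (hb0 : 0 < b) (h0 : Integrable G ν) (hb : Integrable (fun θ => r θ ^ b • G θ) ν)
    (hlog : Integrable (fun θ => Real.log (r θ) • G θ) ν) :
    HasDerivWithinAt (fun a : ℝ => ∫ θ, r θ ^ a • G θ ∂ν) (∫ θ, Real.log (r θ) • G θ ∂ν)
      (Set.Ioi 0) 0 := by
  rw [hasDerivWithinAt_iff_tendsto_slope' Set.self_notMem_Ioi]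
  have hsmall : ∀ᶠ a in 𝓝[>] (0 : ℝ), 0 < a ∧ a ≤ b :=
    (Ioc_mem_nhdsGT hb0 : Set.Ioc 0 b ∈ 𝓝[>] (0 : ℝ))
  have key : Tendsto (fun a : ℝ => ∫ θ, (a⁻¹ * (r θ ^ a - 1)) • G θ ∂ν) (𝓝[>] 0)
      (𝓝 (∫ θ, Real.log (r θ) • G θ ∂ν)) := by
    refine tendsto_integral_filter_of_dominated_convergence
      (fun θ => ‖Real.log (r θ) • G θ‖ + b⁻¹ * ‖r θ ^ b • G θ‖) (Eventually.of_forall fun a => ?_)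
      ?_ (hlog.norm.add (hb.norm.const_mul _)) ?_
    · exact ((hr.pow_const a).sub_const 1 |>.const_mul a⁻¹).aestronglyMeasurable.smul
        h0.aestronglyMeasurable
    · filter_upwards [hsmall] with a ⟨ha, hab⟩
      filter_upwards [hpos] with θ hθ
      rw [norm_smul, norm_smul, norm_smul, Real.norm_of_nonneg (Real.rpow_nonneg hθ.le _),
        ← mul_assoc, ← add_mul]
      exact mul_le_mul_of_nonneg_right (abs_rpow_sub_one_div_le hθ ha hab) (norm_nonneg _)
    · filter_upwards [hpos] with θ hθ
      refine Tendsto.smul_const ?_ _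
      have h1 := (Real.hasStrictDerivAt_const_rpow hθ 0).hasDerivAt.hasDerivWithinAt
        (s := Set.Ioi 0)
      rw [hasDerivWithinAt_iff_tendsto_slope' Set.self_notMem_Ioi] at h1
      simpa [slope_fun_def_field, div_eq_inv_mul] using h1
  refine key.congr' ?_
  filter_upwards [hsmall] with a ⟨ha, hab⟩
  rw [slope, vsub_eq_sub, sub_zero, ← integral_sub (integrable_rpow_smul hr hpos h0 hb ha.le hab)
    (by simpa using h0), ← integral_smul]
  simp [mul_smul, sub_smul]

end RightDerivative

end SPEP

/-! ### Arithmetic of natural parameters and moments of family members. -/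

namespace SPEP

section NatParam

variable {Θ : Type*} {d : ℕ} {T : Θ → Param d} {f g : Θ → ℝ} {η η₁ η₂ : Param d}

lemma HasNatParam.pos (hf : HasNatParam T f η) (θ : Θ) : 0 < f θ := by
  obtain ⟨c, hc⟩ := hf
  rw [hc]
  exact Real.exp_pos _

lemma HasNatParam.mul (hf : HasNatParam T f η₁) (hg : HasNatParam T g η₂) :
    HasNatParam T (fun θ => f θ * g θ) (η₁ + η₂) := by
  obtain ⟨c₁, h₁⟩ := hf
  obtain ⟨c₂, h₂⟩ := hg
  refine ⟨c₁ + c₂, fun θ => ?_⟩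
  beta_reduce
  rw [h₁, h₂, ← Real.exp_add, inner_add_left]
  congr 1; ring

lemma HasNatParam.rpow (hf : HasNatParam T f η) (a : ℝ) :
    HasNatParam T (fun θ => f θ ^ a) (a • η) := by
  obtain ⟨c, h⟩ := hf
  refine ⟨a * c, fun θ => ?_⟩
  beta_reduce
  rw [h, ← Real.exp_mul, real_inner_smul_left]
  congr 1; ring

lemma HasNatParam.div (hf : HasNatParam T f η₁) (hg : HasNatParam T g η₂) :
    HasNatParam T (fun θ => f θ / g θ) (η₁ - η₂) := by
  obtain ⟨c₁, h₁⟩ := hf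
  obtain ⟨c₂, h₂⟩ := hg
  refine ⟨c₁ - c₂, fun θ => ?_⟩
  beta_reduce
  rw [h₁, h₂, ← Real.exp_sub, inner_sub_left]
  congr 1; ring

lemma HasNatParam.const_mul (hf : HasNatParam T f η) {c : ℝ} (hc : 0 < c) :
    HasNatParam T (fun θ => c * f θ) η := by
  obtain ⟨b, h⟩ := hf
  refine ⟨Real.log c + b, fun θ => ?_⟩
  beta_reduce
  rw [h, add_left_comm, Real.exp_add (Real.log c), Real.exp_log hc]

/-- A factor `t` with `q ∝ p * t ^ M` belongs to the family. -/
lemma hasNatParam_factor {M : ℕ} (hM : M ≠ 0) {p q t : Θ → ℝ} {η₀ : Param d}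
    (hp : HasNatParam T p η₀) (hq : HasNatParam T q η) (ht : ∀ θ, 0 < t θ)
    (hqt : ∃ c : ℝ, 0 < c ∧ ∀ θ, q θ = c * (p θ * t θ ^ M)) :
    HasNatParam T t ((M : ℝ)⁻¹ • (η - η₀)) := by
  obtain ⟨c, hc, h⟩ := hqt
  have h1 := (hq.div (hp.const_mul hc)).rpow (M : ℝ)⁻¹
  convert h1 using 2 with θ
  have hpθ := hp.pos θ
  rw [h, show c * (p θ * t θ ^ M) / (c * p θ) = t θ ^ M by field_simp,
    Real.pow_rpow_inv_natCast (ht θ).le hM]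

variable [MeasurableSpace Θ] {ν : Measure Θ}

lemma HasNatParam.unique [NeZero ν] (hmin : IsMinimal T ν) (h₁ : HasNatParam T f η₁)
    (h₂ : HasNatParam T f η₂) : η₁ = η₂ := by
  obtain ⟨c₁, h₁⟩ := h₁
  obtain ⟨c₂, h₂⟩ := h₂
  refine sub_eq_zero.1 (hmin _ ⟨c₂ - c₁, Eventually.of_forall fun θ => ?_⟩)
  have := Real.exp_injective ((h₁ θ).symm.trans (h₂ θ))
  rw [inner_sub_left]
  linarith

lemma hasNatParam_density (T : Θ → Param d) (ν : Measure Θ) (η : Param d) :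
    HasNatParam T (density T ν η) η :=
  ⟨-Real.log (partition T ν η), fun _ => rfl⟩

lemma HasNatParam.exists_eq_mul_density (hf : HasNatParam T f η) (ν : Measure Θ) :
    ∃ c : ℝ, 0 < c ∧ ∀ θ, f θ = c * density T ν η θ := by
  obtain ⟨b, hb⟩ := hf
  refine ⟨Real.exp (b + Real.log (partition T ν η)), Real.exp_pos _, fun θ => ?_⟩
  rw [hb, density, ← Real.exp_add]
  congr 1; ring

lemma expectT_const_mul {c : ℝ} (hc : c ≠ 0) (f : Θ → ℝ) :
    expectT T ν (fun θ => c * f θ) = expectT T ν f := by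
  simp only [expectT, mul_smul, integral_const_mul, integral_smul]
  rw [smul_smul, mul_inv_rev, inv_mul_cancel_right₀ hc]

lemma expectT_density [NeZero ν] (hη : η ∈ natDomain T ν) :
    expectT T ν (density T ν η) = meanParam T ν η := by
  rw [expectT, integral_density hη, inv_one, one_smul, meanParam]

lemma HasNatParam.expectT_eq [NeZero ν] (hf : HasNatParam T f η) (hη : η ∈ natDomain T ν) :
    expectT T ν f = meanParam T ν η := by
  obtain ⟨c, hc, h⟩ := hf.exists_eq_mul_density ν
  rw [funext h, expectT_const_mul hc.ne', expectT_density hη]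

lemma hasMoments_density [NeZero ν] (hT : Measurable T) (hη : η ∈ interior (natDomain T ν)) :
    HasMoments T ν (density T ν η) where
  nonneg := Eventually.of_forall fun θ => (density_pos θ).le
  integrable := integrable_density (interior_subset hη)
  mass_pos := by rw [integral_density (interior_subset hη)]; exact one_pos
  integrable_stat := (hasExpMoment_stat hT hη).integrable_density_smul hT

lemma HasNatParam.integrable_density_smul_stat (hf : HasNatParam T f η) (hm : HasMoments T ν f) :
    Integrable (fun θ => density T ν η θ • T θ) ν := by
  obtain ⟨c, hc, h⟩ := hf.exists_eq_mul_density ν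
  have := hm.integrable_stat
  simp only [h, mul_smul] at this
  exact (integrable_fun_smul_iff hc.ne' _).1 this

end NatParam

/-! ### The SPEP step in natural parameters. -/

section Step

variable {Θ : Type*} {d : ℕ} [MeasurableSpace Θ] {T : Θ → Param d} {ν : Measure Θ} [NeZero ν]
  {M : ℕ} {ρ α : ℝ} {p lik q t : Θ → ℝ} {η η₀ : Param d}

omit [NeZero ν] in
lemma IsStep.hasNatParam {qα q' t' : Θ → ℝ} {e : Param d}
    (h : IsStep T ν M ρ α p lik q t qα q' t') (hp : HasNatParam T p η₀) (hq : HasNatParam T q η)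
    (he : HasNatParam T qα e) :
    HasNatParam T q' (η + (M * ρ / α) • (e - η)) ∧
      HasNatParam T t' ((M : ℝ)⁻¹ • (η + (M * ρ / α) • (e - η) - η₀)) := by
  have h1 : HasNatParam T q' (η + (M * ρ / α) • (e - η)) := by
    have := (hq.rpow (1 - M * ρ / α)).mul (he.rpow (M * ρ / α))
    rw [funext h.posterior]
    convert this using 1
    module
  refine ⟨h1, ?_⟩
  rw [funext h.factor, inv_eq_one_div]
  exact (h1.div hp).rpow _

/-- Any result of a step is determined by the parameter `e` of its projection, which may a priori
lie on the boundary of the natural domain. -/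
lemma Returns.exists_meanParam_eq (hmin : IsMinimal T ν) (hp : HasNatParam T p η₀)
    (hq : HasNatParam T q η) {η' τ' : Param d} (h : Returns T ν M ρ α p lik q t η' τ') :
    ∃ e ∈ natDomain T ν, Integrable (fun θ => density T ν e θ • T θ) ν ∧
      meanParam T ν e = expectT T ν (tilted q t lik α) ∧ η' = η + (M * ρ / α) • (e - η) ∧
      τ' = (M : ℝ)⁻¹ • (η' - η₀) := by
  obtain ⟨qα, q', t', hs, hη', hτ'⟩ := h
  obtain ⟨e, he, hqα⟩ := hs.moment_match.mem_family
  obtain ⟨h1, h2⟩ := hs.hasNatParam hp hq hqα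
  have h3 := hη'.unique (ν := ν) hmin h1
  refine ⟨e, he, hqα.integrable_density_smul_stat hs.moment_match.target, ?_, h3, ?_⟩
  · rw [← hqα.expectT_eq he, hs.moment_match.expect_eq]
  · rw [h3]
    exact hτ'.unique (ν := ν) hmin h2

lemma returns_of_meanParam_eq (hT : Measurable T) (hp : HasNatParam T p η₀)
    (hq : HasNatParam T q η) (hm : HasMoments T ν (tilted q t lik α)) {e : Param d}
    (he : e ∈ interior (natDomain T ν))
    (hmean : meanParam T ν e = expectT T ν (tilted q t lik α)) :
    Returns T ν M ρ α p lik q t (η + (M * ρ / α) • (e - η))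
      ((M : ℝ)⁻¹ • (η + (M * ρ / α) • (e - η) - η₀)) := by
  have he' := interior_subset he
  have hs : IsStep T ν M ρ α p lik q t (density T ν e)
      (fun θ => q θ ^ (1 - M * ρ / α) * density T ν e θ ^ (M * ρ / α))
      (fun θ => (q θ ^ (1 - M * ρ / α) * density T ν e θ ^ (M * ρ / α) / p θ) ^ (1 / (M : ℝ))) :=
    ⟨⟨⟨e, he', hasNatParam_density T ν e⟩, hm, hasMoments_density hT he,
      (expectT_density he').trans hmean⟩, fun _ => rfl, fun _ => rfl⟩
  exact ⟨_, _, _, hs, hs.hasNatParam hp hq (hasNatParam_density T ν e)⟩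

end Step

/-! ### Moments of the tilted distribution for small powers. -/

section Tilted

variable {Θ : Type*} {d : ℕ} [MeasurableSpace Θ] {T : Θ → Param d} {ν : Measure Θ} [NeZero ν]
  {lik q t : Θ → ℝ} {η : Param d} {b : ℝ}

omit [NeZero ν] in
lemma expectT_tilted (hq : HasNatParam T q η) (a : ℝ) :
    expectT T ν (tilted q t lik a) = (∫ θ, (lik θ / t θ) ^ a • density T ν η θ ∂ν)⁻¹ •
      ∫ θ, (lik θ / t θ) ^ a • density T ν η θ • T θ ∂ν := by
  obtain ⟨c, hc, h⟩ := hq.exists_eq_mul_density ν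
  have : tilted q t lik a = fun θ => c * ((lik θ / t θ) ^ a * density T ν η θ) := by
    ext θ
    rw [tilted, h]; ring
  rw [this, expectT_const_mul hc.ne', expectT]
  simp only [smul_smul, smul_eq_mul]

omit [NeZero ν] in
lemma HasMoments.integrable_rpow_smul (hq : HasNatParam T q η)
    (hm : HasMoments T ν (tilted q t lik b)) :
    Integrable (fun θ => (lik θ / t θ) ^ b • density T ν η θ) ν ∧
      Integrable (fun θ => (lik θ / t θ) ^ b • density T ν η θ • T θ) ν := by
  obtain ⟨c, hc, h⟩ := hq.exists_eq_mul_density ν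
  constructor
  · refine (hm.integrable.const_mul c⁻¹).congr (Eventually.of_forall fun θ => ?_)
    simp only [tilted, h, smul_eq_mul]
    field_simp
  · refine (hm.integrable_stat.smul c⁻¹).congr (Eventually.of_forall fun θ => ?_)
    simp only [tilted, h, Pi.smul_apply, smul_smul]
    congr 1
    field_simp

/-- Powers between `0` and `b` are dominated by the two ends: power `0` is `q` itself, and power `b`
is the hypothesis. -/
lemma hasMoments_tilted (hT : Measurable T) (hr : Measurable fun θ => lik θ / t θ)
    (hpos : ∀ᵐ θ ∂ν, 0 < lik θ / t θ) (hq : HasNatParam T q η)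
    (hη : η ∈ interior (natDomain T ν)) (hm : HasMoments T ν (tilted q t lik b)) {a : ℝ}
    (ha : 0 ≤ a) (hab : a ≤ b) : HasMoments T ν (tilted q t lik a) := by
  obtain ⟨c, hc, h⟩ := hq.exists_eq_mul_density ν
  obtain ⟨h1, h2⟩ := hm.integrable_rpow_smul hq
  have hp : ∀ᵐ θ ∂ν, 0 < tilted q t lik a θ :=
    hpos.mono fun θ hθ => mul_pos (hq.pos θ) (Real.rpow_pos_of_pos hθ a)
  have hi : Integrable (tilted q t lik a) ν := by
    refine ((SPEP.integrable_rpow_smul hr hpos (integrable_density (interior_subset hη)) h1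
      ha hab).const_mul c).congr (Eventually.of_forall fun θ => ?_)
    simp only [tilted, h, smul_eq_mul]
    ring
  refine ⟨hp.mono fun _ h => h.le, hi, ?_, ?_⟩
  · rw [integral_pos_iff_support_of_nonneg_ae (hp.mono fun _ h => h.le) hi]
    refine pos_iff_ne_zero.2 fun h0 => ?_
    have h3 : ∀ᵐ θ ∂ν, θ ∉ Function.support (tilted q t lik a) := measure_eq_zero_iff_ae_notMem.1 h0
    obtain ⟨θ, hθ, hθ'⟩ := (hp.and h3).exists
    exact hθ' hθ.ne'
  · refine ((SPEP.integrable_rpow_smul hr hpos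
      ((hasExpMoment_stat hT hη).integrable_density_smul hT) h2 ha hab).smul c).congr
      (Eventually.of_forall fun θ => ?_)
    simp only [tilted, h, Pi.smul_apply, smul_smul]
    congr 1
    ring

lemma expectT_tilted_zero (hq : HasNatParam T q η) (hη : η ∈ natDomain T ν) :
    expectT T ν (tilted q t lik 0) = meanParam T ν η := by
  rw [expectT_tilted hq]
  simp only [Real.rpow_zero, one_smul]
  exact expectT_density hη

/-- The right derivative at `α = 0` of the mean of `T` under the tilted distribution. -/
theorem hasDerivWithinAt_expectT_tilted (hT : Measurable T)
    (hr : Measurable fun θ => lik θ / t θ) (hpos : ∀ᵐ θ ∂ν, 0 < lik θ / t θ)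
    (hq : HasNatParam T q η) (hη : η ∈ interior (natDomain T ν)) (hb : 0 < b)
    (hm : HasMoments T ν (tilted q t lik b))
    (hs : HasExpMoment T ν η (fun θ => Real.log (lik θ / t θ))) :
    HasDerivWithinAt (fun a => expectT T ν (tilted q t lik a))
      (covVec T ν (fun θ => Real.log (lik θ / t θ)) η) (Set.Ioi 0) 0 := by
  obtain ⟨h1, h2⟩ := hm.integrable_rpow_smul hq
  have hη' := interior_subset hη
  have hs1 := hs.integrable_density_smul hT
  have hsT : Integrable (fun θ => Real.log (lik θ / t θ) • density T ν η θ • T θ) ν := by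
    have := hs.integrable_covVec hT 0
    simp only [sub_zero] at this
    exact this.congr (Eventually.of_forall fun θ => smul_comm _ _ _)
  have hs1' : Integrable (fun θ => Real.log (lik θ / t θ) • density T ν η θ) ν := by
    simpa only [smul_eq_mul, mul_comm] using hs1
  have d1 := hasDerivWithinAt_integral_rpow_smul hr hpos hb (integrable_density hη') h1 hs1'
  have dT := hasDerivWithinAt_integral_rpow_smul hr hpos hb
    ((hasExpMoment_stat hT hη).integrable_density_smul hT) h2 hsT
  have hne : ∫ θ, (lik θ / t θ) ^ (0 : ℝ) • density T ν η θ ∂ν ≠ 0 := by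
    simp [integral_density hη']
  -- Product rule for inverse mass times first moment; the mass at power `0` is `1`, so only the
  -- covariance remains.
  have hd := (d1.fun_inv hne).fun_smul dT
  simp only [Real.rpow_zero, one_smul, integral_density hη', inv_one, one_pow, div_one] at hd
  simp only [expectT_tilted hq]
  refine hd.congr_deriv (Eq.symm ?_)
  have hμ : ∫ θ, density T ν η θ • T θ ∂ν = meanParam T ν η := rfl
  rw [covVec, expectation, hμ, neg_smul, ← sub_eq_add_neg, ← integral_smul_const,
    ← integral_sub hsT (hs1'.smul_const _)]
  congr 1 with θ : 1
  rw [smul_sub, smul_sub, smul_comm, smul_smul (density T ν η θ), smul_eq_mul, mul_comm]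

end Tilted

end SPEP

/-! ### The small power limit of the step. -/

theorem mainTheorem5
    {Θ : Type*} [MeasurableSpace Θ] (ν : Measure Θ) [NeZero ν]
    {d : ℕ} (T : Θ → SPEP.Param d) (hT : Measurable T) (hmin : SPEP.IsMinimal T ν)
    -- the likelihood factors of the `M` data partitions, and the partition that is visited
    {M : ℕ} (lik : Fin M → Θ → ℝ) (k : Fin M)
    (hlik : Measurable (lik k)) (hlik_pos : ∀ᵐ θ ∂ν, 0 < lik k θ)
    (ρ : ℝ)
    -- prior, current approximate posterior and current average likelihood factor, `q ∝ p * t ^ M`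
    (p q t : Θ → ℝ) (η₀ η : SPEP.Param d)
    (hp : SPEP.HasNatParam T p η₀)
    (hq : SPEP.HasNatParam T q η) (hη : η ∈ interior (SPEP.natDomain T ν))
    (ht : ∀ θ, 0 < t θ) (hqt : ∃ c : ℝ, 0 < c ∧ ∀ θ, q θ = c * (p θ * t θ ^ M))
    -- the expected log likelihood is defined near the current approximate posterior
    (hlog : ∀ᶠ η' in 𝓝 η,
      Integrable (fun θ => SPEP.density T ν η' θ * Real.log (lik k θ)) ν)
    -- the tilted distribution of some positive power has an expectation of `T`
    (htilt : ∃ α₀ : ℝ, 0 < α₀ ∧ SPEP.HasMoments T ν (SPEP.tilted q t (lik k) α₀)) :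
    -- the derivative in the mini-batch update exists
    DifferentiableAt ℝ (SPEP.meanExpectation T ν (fun θ => Real.log (lik k θ)))
      (SPEP.meanParam T ν η) ∧
    -- for all small `α > 0` the step can be carried out, with a unique result
    (∀ᶠ α in 𝓝[>] (0 : ℝ),
      ∃! r : SPEP.Param d × SPEP.Param d,
        SPEP.Returns T ν M ρ α p (lik k) q t r.1 r.2) ∧
    -- the result converges to the mini-batch update
    (∀ η' τ' : ℝ → SPEP.Param d,
      (∀ᶠ α in 𝓝[>] (0 : ℝ), SPEP.Returns T ν M ρ α p (lik k) q t (η' α) (τ' α)) →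
        Tendsto η' (𝓝[>] 0) (𝓝 (SPEP.miniBatchUpdate T ν M ρ η₀ (lik k) η)) ∧
        Tendsto τ' (𝓝[>] 0)
          (𝓝 ((M : ℝ)⁻¹ • (SPEP.miniBatchUpdate T ν M ρ η₀ (lik k) η - η₀)))) ∧
    -- the second form of the mini-batch update, with the deletion step made explicit
    SPEP.miniBatchUpdate T ν M ρ η₀ (lik k) η =
      η + ((M : ℝ) * ρ) •
        (SPEP.meanGradient T ν (fun θ => Real.log (lik k θ)) η - (M : ℝ)⁻¹ • (η - η₀)) := by

  have hM : M ≠ 0 := fun h => (h ▸ k).elim0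
  have hη' := interior_subset hη
  have htn := SPEP.hasNatParam_factor hM hp hq ht hqt
  set τ : SPEP.Param d := (M : ℝ)⁻¹ • (η - η₀) with hτ
  set f : Θ → ℝ := fun θ => Real.log (lik k θ) with hf_def
  have hf : SPEP.HasExpMoment T ν η f :=
    SPEP.hasExpMoment_of_eventually hT
      (hlog.mono fun _ h => SPEP.integrable_density_smul_iff.1 h)
  obtain ⟨b, hb, hm⟩ := htilt
  obtain ⟨K, hK⟩ := SPEP.exists_equiv_eq_covariance_stat hT hmin hη
  have hupdate : SPEP.miniBatchUpdate T ν M ρ η₀ (lik k) η =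
      η + ((M : ℝ) * ρ) • (SPEP.meanGradient T ν f η - τ) := by
    have hM' : (M : ℝ) ≠ 0 := Nat.cast_ne_zero.2 hM
    rw [SPEP.miniBatchUpdate, hτ, smul_sub, smul_smul, mul_right_comm, mul_inv_cancel₀ hM', one_mul]
    module
  obtain ⟨c, hc⟩ := htn
  have hr : Measurable fun θ => lik k θ / t θ := by
    rw [show t = fun θ => Real.exp (inner ℝ τ (T θ) + c) from funext hc]
    fun_prop
  have hpos : ∀ᵐ θ ∂ν, 0 < lik k θ / t θ := hlik_pos.mono fun θ h => div_pos h (ht θ)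
  have hs : (fun θ => f θ - (inner ℝ τ (T θ) + c)) =ᵐ[ν] fun θ => Real.log (lik k θ / t θ) :=
    hlik_pos.mono fun θ h => by
      simp only [hf_def]
      rw [Real.log_div h.ne' (ht θ).ne', hc θ, Real.log_exp]
  have hsm := (hf.sub hT (SPEP.hasExpMoment_inner_add_const hT hη τ c)).congr hs
  set m : ℝ → SPEP.Param d := fun a => SPEP.expectT T ν (SPEP.tilted q t (lik k) a) with hm_def
  have hm0 : m 0 = SPEP.meanParam T ν η := SPEP.expectT_tilted_zero hq hη'
  have hmd : HasDerivWithinAt m (K (SPEP.meanGradient T ν f η - τ)) (Set.Ioi 0) 0 := by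
    have := SPEP.hasDerivWithinAt_expectT_tilted hT hr hpos hq hη hb hm hsm
    rwa [SPEP.covVec_sub_inner hT hmin hη hf τ c hs, ← hK] at this
  have hmt : Tendsto m (𝓝[>] 0) (𝓝 (SPEP.meanParam T ν η)) := hm0 ▸ hmd.continuousWithinAt
  -- the natural parameter of the projection, and its derivative at `α = 0`
  set e : ℝ → SPEP.Param d := fun a => SPEP.natOfMean T ν (m a) with he_def
  have he0 : e 0 = η := by rw [he_def]; simp only [hm0]; exact SPEP.natOfMean_meanParam hT hmin hη
  have hed : HasDerivWithinAt e (SPEP.meanGradient T ν f η - τ) (Set.Ioi 0) 0 := by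
    have h1 := (SPEP.hasStrictFDerivAt_natOfMean hT hmin hη hK).hasFDerivAt
    rw [← hm0] at h1
    exact (h1.comp_hasDerivWithinAt 0 hmd).congr_deriv (K.symm_apply_apply _)
  have he : ∀ᶠ a in 𝓝[>] (0 : ℝ), 0 < a ∧ a ≤ b ∧
      e a ∈ interior (SPEP.natDomain T ν) ∧ SPEP.meanParam T ν (e a) = m a := by
    filter_upwards [Ioc_mem_nhdsGT hb, hmt.eventually (SPEP.eventually_natOfMean hT hmin hη)]
      with a ha h
    exact ⟨ha.1, ha.2, h⟩
  -- Every admissible projection has mean `m a`, so injectivity up to the boundary forces its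
  -- parameter to be `e a`.
  have hres : ∀ a, e a ∈ interior (SPEP.natDomain T ν) → SPEP.meanParam T ν (e a) = m a →
      ∀ η' τ', SPEP.Returns T ν M ρ a p (lik k) q t η' τ' →
        η' = η + (M * ρ / a) • (e a - η) ∧ τ' = (M : ℝ)⁻¹ • (η' - η₀) := by
    intro a h1 h2 η' τ' hret
    obtain ⟨e', he'1, he'2, he'3, he'4, he'5⟩ := hret.exists_meanParam_eq hmin hp hq
    have : e' = e a := SPEP.eq_of_meanParam_eq hmin he'1 (interior_subset h1) he'2
      ((SPEP.hasExpMoment_stat hT h1).integrable_density_smul hT) (he'3.trans h2.symm)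
    exact ⟨this ▸ he'4, he'5⟩
  refine ⟨SPEP.differentiableAt_meanExpectation hT hmin hη hf, ?_, fun η' τ' hret => ?_, hupdate⟩
  · filter_upwards [he] with a ⟨ha, hab, h1, h2⟩
    refine ⟨⟨_, _⟩, SPEP.returns_of_meanParam_eq hT hp hq
      (SPEP.hasMoments_tilted hT hr hpos hq hη hm ha.le hab) h1 h2, ?_⟩
    rintro ⟨η', τ'⟩ hret
    obtain ⟨h3, h4⟩ := hres a h1 h2 _ _ hret
    simp only [Prod.mk.injEq]
    exact ⟨h3, h3 ▸ h4⟩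
  · have hη_lim : Tendsto η' (𝓝[>] 0) (𝓝 (SPEP.miniBatchUpdate T ν M ρ η₀ (lik k) η)) := by
      rw [hupdate]
      rw [hasDerivWithinAt_iff_tendsto_slope' Set.self_notMem_Ioi] at hed
      -- The increment `(M ρ / a) (e a - η)` is `M ρ` times the slope of `e` between `0` and `a`.
      refine ((hed.const_smul ((M : ℝ) * ρ)).const_add η).congr' ?_
      filter_upwards [he, hret] with a ⟨_, _, h1, h2⟩ hr'
      rw [(hres a h1 h2 _ _ hr').1, slope, he0, sub_zero, vsub_eq_sub, smul_smul, div_eq_mul_inv]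
    refine ⟨hη_lim, ((hη_lim.sub_const η₀).const_smul (M : ℝ)⁻¹).congr' ?_⟩
    filter_upwards [he, hret] with a ⟨_, _, h1, h2⟩ hr'
    exact (hres a h1 h2 _ _ hr').2.symm
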